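/- Let $M$ be a nonempty smooth (Hausdorff, $\sigma$-compact, boundaryless) manifold of dimension $2n+1$, $n\ge 0$, with a fixed contact form $\alpha$, i.e. a smooth nowhere vanishing 1-form such that $d\alpha$ is nondegenerate on $\xi=\ker\alpha$. A contactomorphism is a diffeomorphism $\varphi$ of $M$ with $\varphi^*\alpha=e^{g}\alpha$ for some function $g$, its conformal factor. A contact isotopy is a family $(\varphi_t)_{t\in[0,1]}$ of contactomorphisms, smooth in $(t,x)$, with $\varphi_0=\mathrm{id}$ and supported in a compact set independent of $t$ (no condition if $M$ is compact); its contact Hamiltonian is the smooth function $H$ on $[0,1]\times M$ with $H_t(\varphi_t(x))=\alpha\big(\tfrac{d}{dt}\varphi_t(x)\big)$, and we say that $H$ generates $\varphi_1$. Let $\mathrm{Cont}_0(M,\xi)$ be the set of all time-one maps of contact isotopies. For $\varphi\in \mathrm{Cont}_0(M,\xi)$ put $$\|\varphi\|_\alpha=\inf \int_0^1\max_M|H_t|\,dt,$$ the infimum being over all contact Hamiltonians $H$ that generate $\varphi$. For $N\subseteq M$ let $\mathcal L(N)=\{\varphi(N) : \varphi\in\mathrm{Cont}_0(M,\xi)\}$,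 and for $L_1,L_2\in\mathcal L(N)$ put $$\delta_\alpha(L_1,L_2)=\inf\{\|\varphi\|_\alpha : \varphi\in\mathrm{Cont}_0(M,\xi),\ \varphi(L_1)=L_2\}.$$ Then for every subset $N\subseteq M$, $\delta_\alpha$ is a pseudo-metric on $\mathcal L(N)$: for all $L,L_1,L_2,L_3\in\mathcal L(N)$, 1. $\delta_\alpha(L,L)=0$; 2. $\delta_\alpha(L_1,L_2)=\delta_\alpha(L_2,L_1)\ge 0$; 3. $\delta_\alpha(L_1,L_3)\le\delta_\alpha(L_1,L_2)+\delta_\alpha(L_2,L_3)$. Moreover: 4. If $\psi$ is a contactomorphism generated by a contact Hamiltonian $F$, then $\psi^*\alpha=e^f\alpha$ for a smooth function $f$ on $M$, the numbers $C_-=\min_M e^f$ and $C_+=\max_M e^f$ exist and are positive, and for every $N\subseteq M$ and all $L_1,L_2\in\mathcal L(N)$ one has $\psi(L_1),\psi(L_2)\in\mathcal L(N)$ and $$C_-\,\delta_\alpha(L_1,L_2)\le\delta_\alpha(\psi(L_1),\psi(L_2))\le C_+\,\delta_\alpha(L_1,L_2).$$ -/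

import Mathlib

open Set
open scoped Manifold ContDiff

noncomputable section

namespace ContactGeometry

/-- The model space `ℝ^(2n+1)` of a `(2n+1)`-dimensional manifold. -/
abbrev Model (n : ℕ) : Type := EuclideanSpace ℝ (Fin (2 * n + 1))

section

variable {n : ℕ} {M : Type*} [TopologicalSpace M] [ChartedSpace (Model n) M]

/-- The coordinate expression, in the preferred chart around `p`, of a differential 1-form `α`
on `M`: the pullback of `α` under the inverse chart, as a 1-form on (the chart target in)
`ℝ^(2n+1)`. -/
def coordForm (α : ∀ x : M, TangentSpace (𝓡 (2 * n + 1)) x →L[ℝ] ℝ) (p : M) (y : Model n) :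
    Model n [⋀^Fin 1]→L[ℝ] ℝ :=
  ContinuousAlternatingMap.ofSubsingleton ℝ (Model n) ℝ (0 : Fin 1)
    ((α ((extChartAt (𝓡 (2 * n + 1)) p).symm y)).comp
      (mfderiv 𝓘(ℝ, Model n) (𝓡 (2 * n + 1)) (extChartAt (𝓡 (2 * n + 1)) p).symm y))

/-- The exterior derivative `dα` of a 1-form at the point `p`, evaluated at two tangent vectors,
computed in the preferred chart around `p`. -/
def extDerivForm (α : ∀ x : M, TangentSpace (𝓡 (2 * n + 1)) x →L[ℝ] ℝ) (p : M)
    (v w : TangentSpace (𝓡 (2 * n + 1)) p) : ℝ :=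
  extDeriv (coordForm α p) (extChartAt (𝓡 (2 * n + 1)) p p)
    ![mfderiv (𝓡 (2 * n + 1)) 𝓘(ℝ, Model n) (extChartAt (𝓡 (2 * n + 1)) p) p v,
      mfderiv (𝓡 (2 * n + 1)) 𝓘(ℝ, Model n) (extChartAt (𝓡 (2 * n + 1)) p) p w]

end

/-- A (smooth) contact form on a `(2n+1)`-dimensional manifold `M`: a smooth nowhere vanishing
1-form `α` such that `dα` is nondegenerate on `ξ = ker α` at every point; in dimension `2n+1` this
is the condition `α ∧ (dα)^n ≠ 0`. -/
structure ContactForm (n : ℕ) (M : Type*) [TopologicalSpace M] [ChartedSpace (Model n) M]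
    [IsManifold (𝓡 (2 * n + 1)) ∞ M] where
  /-- the underlying 1-form -/
  form : ∀ x : M, TangentSpace (𝓡 (2 * n + 1)) x →L[ℝ] ℝ
  /-- the 1-form is a smooth section of the cotangent bundle -/
  smooth : ContMDiff (𝓡 (2 * n + 1)) ((𝓡 (2 * n + 1)).prod 𝓘(ℝ, Model n →L[ℝ] ℝ)) ∞
    (fun x => Bundle.TotalSpace.mk' (Model n →L[ℝ] ℝ)
      (E := fun x : M => TangentSpace (𝓡 (2 * n + 1)) x →L[ℝ] Bundle.Trivial M ℝ x) x (form x))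
  ne_zero : ∀ x, form x ≠ 0
  nondegenerate : ∀ (x : M) (v : TangentSpace (𝓡 (2 * n + 1)) x), form x v = 0 →
    (∀ w : TangentSpace (𝓡 (2 * n + 1)) x, form x w = 0 → extDerivForm form x v w = 0) → v = 0

section

variable {n : ℕ} {M : Type*} [TopologicalSpace M] [ChartedSpace (Model n) M]
  [IsManifold (𝓡 (2 * n + 1)) ∞ M]

/-- `g` is the conformal factor of the diffeomorphism `φ` with respect to `α`:
`φ^* α = e^g α`. -/
def IsConformalFactor (α : ContactForm n M)
    (φ : M ≃ₘ^∞⟮𝓡 (2 * n + 1), 𝓡 (2 * n + 1)⟯ M) (g : M → ℝ) : Prop :=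
  ∀ (x : M) (v : TangentSpace (𝓡 (2 * n + 1)) x),
    α.form (φ x) (mfderiv (𝓡 (2 * n + 1)) (𝓡 (2 * n + 1)) φ x v) = Real.exp (g x) * α.form x v

/-- `φ` is a contactomorphism of `(M, ker α)`: `φ^* α = e^g α` for some function `g`. -/
def IsContactomorphism (α : ContactForm n M)
    (φ : M ≃ₘ^∞⟮𝓡 (2 * n + 1), 𝓡 (2 * n + 1)⟯ M) : Prop :=
  ∃ g : M → ℝ, IsConformalFactor α φ g

/-- `(φ_t)`, `t ∈ [0,1]`, is a (compactly supported, smooth) contact isotopy starting at the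
identity, and `H : [0,1] × M → ℝ` is its contact Hamiltonian with respect to `α`: `H` is smooth
and `α(X_t) = H_t`, where `X_t` is the contact vector field with `d/dt φ_t = X_t ∘ φ_t`.
The values of `φ` and `H` at times outside `[0,1]` are irrelevant. If `M` is compact, the
condition on the support is empty (take `K = M`). -/
structure IsContactIsotopy (α : ContactForm n M)
    (φ : ℝ → M ≃ₘ^∞⟮𝓡 (2 * n + 1), 𝓡 (2 * n + 1)⟯ M) (H : ℝ → M → ℝ) : Prop where
  start : ∀ x, φ 0 x = x
  smooth : ContMDiffOn (𝓘(ℝ, ℝ).prod (𝓡 (2 * n + 1))) (𝓡 (2 * n + 1)) ∞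
    (fun p : ℝ × M => φ p.1 p.2) (Icc 0 1 ×ˢ univ)
  contact : ∀ t ∈ Icc (0 : ℝ) 1, IsContactomorphism α (φ t)
  compactSupport : ∃ K : Set M, IsCompact K ∧ ∀ t ∈ Icc (0 : ℝ) 1, ∀ x ∉ K, φ t x = x
  smooth_hamiltonian : ContMDiffOn (𝓘(ℝ, ℝ).prod (𝓡 (2 * n + 1))) 𝓘(ℝ, ℝ) ∞
    (fun p : ℝ × M => H p.1 p.2) (Icc 0 1 ×ˢ univ)
  hamiltonian : ∀ t ∈ Icc (0 : ℝ) 1, ∀ x : M,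
    α.form (φ t x) (mfderivWithin 𝓘(ℝ, ℝ) (𝓡 (2 * n + 1)) (fun s => φ s x) (Icc 0 1) t (1 : ℝ))
      = H t (φ t x)

/-- The contactomorphism `ψ` is generated by the contact Hamiltonian `F`: it is the time-one map
of the contact isotopy of `F`. -/
def IsGeneratedBy (α : ContactForm n M) (ψ : M ≃ₘ^∞⟮𝓡 (2 * n + 1), 𝓡 (2 * n + 1)⟯ M)
    (F : ℝ → M → ℝ) : Prop :=
  ∃ φ : ℝ → M ≃ₘ^∞⟮𝓡 (2 * n + 1), 𝓡 (2 * n + 1)⟯ M, IsContactIsotopy α φ F ∧ φ 1 = ψ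

/-- The group `Cont₀(M, ξ)` of (compactly supported) contactomorphisms isotopic to the identity
through (compactly supported) contactomorphisms. -/
def Cont₀ (α : ContactForm n M) : Set (M ≃ₘ^∞⟮𝓡 (2 * n + 1), 𝓡 (2 * n + 1)⟯ M) :=
  {φ | ∃ H : ℝ → M → ℝ, IsGeneratedBy α φ H}

/-- Shelukhin's norm: the infimum of `∫₀¹ max_M |H_t| dt` over all contact isotopies
with time-one map `φ`, `H` being the associated contact Hamiltonian. -/
def shelukhinNorm (α : ContactForm n M) (φ : M ≃ₘ^∞⟮𝓡 (2 * n + 1), 𝓡 (2 * n + 1)⟯ M) : ℝ :=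
  sInf {c : ℝ | ∃ H : ℝ → M → ℝ, IsGeneratedBy α φ H ∧ c = ∫ t in (0 : ℝ)..1, ⨆ x : M, |H t x|}

/-- The orbit space `𝓛(N)` of a subset `N ⊆ M` under `Cont₀(M, ξ)`. -/
def orbitSpace (α : ContactForm n M) (N : Set M) : Set (Set M) :=
  {L | ∃ φ ∈ Cont₀ α, φ '' N = L}

/-- The `α`-metric `δ_α(L₁, L₂) = inf {‖φ‖_α | φ ∈ Cont₀(M, ξ), φ(L₁) = L₂}`. -/
def alphaMetric (α : ContactForm n M) (L₁ L₂ : Set M) : ℝ :=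
  sInf {c : ℝ | ∃ φ ∈ Cont₀ α, φ '' L₁ = L₂ ∧ c = shelukhinNorm α φ}

end

end ContactGeometry

end

namespace ContactGeometry

open Filter Topology

section

variable {n : ℕ} {M : Type*} [TopologicalSpace M] [ChartedSpace (Model n) M]

/-! Each property of `alphaMetric` comes from an operation on contact isotopies whose effect on the
Hamiltonian is explicit. The constant isotopy has Hamiltonian 0. Running an isotopy backwards gives
`-H (1 - t)`, of the same length. Concatenation adds lengths. Conjugation by a contactomorphism `θ`
with `θ^*α = e^f α` gives `(e^f H_t) ∘ θ⁻¹`, so lengths grow by at most the factor `max e^f`. Taking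
infima yields `shelukhinNorm_refl`, `shelukhinNorm_symm_le`, `shelukhinNorm_trans_le` and
`shelukhinNorm_conj_le`, and a second infimum transfers them to `alphaMetric`. For the distortion
bounds, `φ(L₁) = L₂` forces `θφθ⁻¹(θL₁) = θL₂`, which gives the upper estimate; the lower one is the
upper one for `θ⁻¹`. The extrema of `e^f` exist even on noncompact `M`, because `f` is continuous
with compact support. All velocity computations go through `speed`, which obeys a chain rule under
time changes and under contactomorphisms. -/

theorem diffeomorph_symm_image_eq {φ : M ≃ₘ^∞⟮𝓡 (2 * n + 1), 𝓡 (2 * n + 1)⟯ M} {L₁ L₂ : Set M}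
    (h : φ '' L₁ = L₂) : φ.symm '' L₂ = L₁ := by
  rw [← h, image_image]
  simp

variable [IsManifold (𝓡 (2 * n + 1)) ∞ M]

/-! ### The contact form evaluated on the velocity of a curve -/

/-- The value of `α` on the velocity at time `t` of a curve parametrised by `[0,1]`. -/
noncomputable def speed (α : ContactForm n M) (c : ℝ → M) (t : ℝ) : ℝ :=
  α.form (c t) (mfderivWithin 𝓘(ℝ, ℝ) (𝓡 (2 * n + 1)) c (Icc 0 1) t (1 : ℝ))

theorem speed_congr (α : ContactForm n M) {c c' : ℝ → M} {t : ℝ} (ht : t ∈ Icc (0 : ℝ) 1)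
    (h : c =ᶠ[𝓝[Icc 0 1] t] c') : speed α c t = speed α c' t := by
  have hct : c t = c' t := h.eq_of_nhdsWithin ht
  have hd := h.mfderivWithin_eq_of_mem (I := 𝓘(ℝ, ℝ)) (I' := 𝓡 (2 * n + 1)) ht
  -- The two covectors live on tangent spaces at formally different points. All these spaces unfold
  -- to `Model n`, so the comparison is made for `w : Model n`, where the equality of points can be
  -- substituted.
  have key : ∀ (y : M) (w : Model n), c t = y →
      (α.form (c t) : Model n → ℝ) w = (α.form y : Model n → ℝ) w := by
    rintro y w rfl
    rfl
  exact (congrArg (fun A : ℝ →L[ℝ] Model n => (α.form (c t) : Model n → ℝ) (A 1)) hd).trans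
    (key _ _ hct)

theorem uniqueMDiffWithinAt_unitInterval {t : ℝ} (ht : t ∈ Icc (0 : ℝ) 1) :
    UniqueMDiffWithinAt 𝓘(ℝ, ℝ) (Icc (0 : ℝ) 1) t :=
  ((uniqueDiffOn_Icc one_pos) t ht).uniqueMDiffWithinAt

theorem speed_const (α : ContactForm n M) (x : M) (t : ℝ) : speed α (fun _ => x) t = 0 := by
  simp only [speed, mfderivWithin_const]
  exact map_zero (α.form x : Model n →L[ℝ] ℝ)

/-- Reparametrising a curve multiplies its speed by the derivative of the parameter change. -/
theorem speed_comp (α : ContactForm n M) {c : ℝ → M} {χ : ℝ → ℝ} {t χ' : ℝ}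
    (ht : t ∈ Icc (0 : ℝ) 1) (hχ : MapsTo χ (Icc 0 1) (Icc 0 1)) (hd : HasDerivAt χ χ' t)
    (hc : MDifferentiableWithinAt 𝓘(ℝ, ℝ) (𝓡 (2 * n + 1)) c (Icc 0 1) (χ t)) :
    speed α (fun s => c (χ s)) t = χ' * speed α c (χ t) := by
  have h1 : HasMFDerivWithinAt 𝓘(ℝ, ℝ) 𝓘(ℝ, ℝ) χ (Icc 0 1) t
      (ContinuousLinearMap.toSpanSingleton ℝ χ') :=
    (hd.hasDerivWithinAt.hasFDerivWithinAt).hasMFDerivWithinAt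
  have h2 := (hc.hasMFDerivWithinAt.comp t h1 hχ).mfderivWithin
    (uniqueMDiffWithinAt_unitInterval ht)
  have h3 : (mfderivWithin 𝓘(ℝ, ℝ) (𝓡 (2 * n + 1)) (c ∘ χ) (Icc 0 1) t : ℝ → Model n) 1 =
      χ' • (mfderivWithin 𝓘(ℝ, ℝ) (𝓡 (2 * n + 1)) c (Icc 0 1) (χ t) : ℝ → Model n) 1 := by
    have h4 := congrArg (fun A : ℝ →L[ℝ] Model n => A 1) h2
    refine h4.trans ?_
    have h5 : (ContinuousLinearMap.toSpanSingleton ℝ χ' : ℝ →L[ℝ] ℝ) 1 = χ' • (1 : ℝ) := by simp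
    refine (congrArg (mfderivWithin 𝓘(ℝ, ℝ) (𝓡 (2 * n + 1)) c (Icc 0 1) (χ t) :
      ℝ → Model n) h5).trans ?_
    exact map_smul (mfderivWithin 𝓘(ℝ, ℝ) (𝓡 (2 * n + 1)) c (Icc 0 1) (χ t) :
      ℝ →L[ℝ] Model n) χ' 1
  exact (congrArg (α.form (c (χ t)) : Model n → ℝ) h3).trans
    (map_smul (α.form (c (χ t)) : Model n →L[ℝ] ℝ) χ' _)

/-- A contactomorphism multiplies the speed of a curve by its conformal factor. -/
theorem IsConformalFactor.speed_comp {α : ContactForm n M}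
    {ψ : M ≃ₘ^∞⟮𝓡 (2 * n + 1), 𝓡 (2 * n + 1)⟯ M} {f : M → ℝ} (hf : IsConformalFactor α ψ f)
    {c : ℝ → M} {t : ℝ} (ht : t ∈ Icc (0 : ℝ) 1)
    (hc : MDifferentiableWithinAt 𝓘(ℝ, ℝ) (𝓡 (2 * n + 1)) c (Icc 0 1) t) :
    speed α (fun s => ψ (c s)) t = Real.exp (f (c t)) * speed α c t := by
  have h := mfderiv_comp_mfderivWithin (I := 𝓘(ℝ, ℝ)) (I' := 𝓡 (2 * n + 1))
    (I'' := 𝓡 (2 * n + 1)) t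
    (ψ.contMDiff.mdifferentiable (by simp) (c t)) hc (uniqueMDiffWithinAt_unitInterval ht)
  refine (congrArg (fun A : ℝ →L[ℝ] Model n => (α.form (ψ (c t)) : Model n → ℝ) (A 1)) h).trans ?_
  exact hf (c t) _

/-! ### Conformal factors -/

theorem IsConformalFactor.trans {α : ContactForm n M}
    {φ ψ : M ≃ₘ^∞⟮𝓡 (2 * n + 1), 𝓡 (2 * n + 1)⟯ M} {f g : M → ℝ}
    (hf : IsConformalFactor α φ f) (hg : IsConformalFactor α ψ g) :
    IsConformalFactor α (φ.trans ψ) (fun x => g (φ x) + f x) := by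
  intro x v
  have h := mfderiv_comp (I := 𝓡 (2 * n + 1)) (I' := 𝓡 (2 * n + 1)) (I'' := 𝓡 (2 * n + 1)) x
    (ψ.contMDiff.mdifferentiable (by simp) (φ x)) (φ.contMDiff.mdifferentiable (by simp) x)
  refine (congrArg (fun A : Model n →L[ℝ] Model n =>
    (α.form (ψ (φ x)) : Model n → ℝ) (A v)) h).trans ?_
  refine (hg (φ x) _).trans ?_
  rw [Real.exp_add, mul_assoc]
  exact congrArg (Real.exp (g (φ x)) * ·) (hf x v)

theorem IsConformalFactor.refl (α : ContactForm n M) :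
    IsConformalFactor α (Diffeomorph.refl (𝓡 (2 * n + 1)) M ∞) (fun _ => 0) := by
  intro x v
  have h : mfderiv (𝓡 (2 * n + 1)) (𝓡 (2 * n + 1)) (id : M → M) x =
    ContinuousLinearMap.id ℝ (TangentSpace (𝓡 (2 * n + 1)) x) := mfderiv_id
  refine (congrArg (fun A : Model n →L[ℝ] Model n =>
    (α.form x : Model n → ℝ) (A v)) h).trans ?_
  rw [Real.exp_zero, one_mul]
  rfl

theorem IsConformalFactor.symm {α : ContactForm n M}
    {φ : M ≃ₘ^∞⟮𝓡 (2 * n + 1), 𝓡 (2 * n + 1)⟯ M} {f : M → ℝ}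
    (hf : IsConformalFactor α φ f) :
    IsConformalFactor α φ.symm (fun x => - f (φ.symm x)) := by
  intro x v
  have h := mfderiv_comp (I := 𝓡 (2 * n + 1)) (I' := 𝓡 (2 * n + 1)) (I'' := 𝓡 (2 * n + 1)) x
    (φ.contMDiff.mdifferentiable (by simp) (φ.symm x))
    (φ.symm.contMDiff.mdifferentiable (by simp) x)
  have hid : (φ ∘ φ.symm : M → M) = id := by ext y; simp
  have h1 : mfderiv (𝓡 (2 * n + 1)) (𝓡 (2 * n + 1)) (φ ∘ φ.symm : M → M) x =
      ContinuousLinearMap.id ℝ (Model n) := by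
    rw [hid]
    exact mfderiv_id
  have h2 := (congrArg (fun A : Model n →L[ℝ] Model n => A v) (h1.symm.trans h))
  have h3 := hf (φ.symm x) (mfderiv (𝓡 (2 * n + 1)) (𝓡 (2 * n + 1)) φ.symm x v)
  have key : ∀ (y : M) (w : Model n), x = y →
      (α.form x : Model n → ℝ) w = (α.form y : Model n → ℝ) w := by
    rintro y w rfl
    rfl
  have h4 : α.form x v = Real.exp (f (φ.symm x)) *
      α.form (φ.symm x) (mfderiv (𝓡 (2 * n + 1)) (𝓡 (2 * n + 1)) φ.symm x v) :=
    ((key _ _ (φ.apply_symm_apply x).symm).trans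
      (congrArg (α.form (φ (φ.symm x)) : Model n → ℝ) h2)).trans h3
  rw [h4, ← mul_assoc, ← Real.exp_add, neg_add_cancel, Real.exp_zero, one_mul]

theorem IsContactomorphism.refl (α : ContactForm n M) :
    IsContactomorphism α (Diffeomorph.refl (𝓡 (2 * n + 1)) M ∞) :=
  ⟨_, IsConformalFactor.refl α⟩

theorem IsContactomorphism.trans {α : ContactForm n M}
    {φ ψ : M ≃ₘ^∞⟮𝓡 (2 * n + 1), 𝓡 (2 * n + 1)⟯ M} (hφ : IsContactomorphism α φ)
    (hψ : IsContactomorphism α ψ) : IsContactomorphism α (φ.trans ψ) :=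
  let ⟨_, hf⟩ := hφ
  let ⟨_, hg⟩ := hψ
  ⟨_, hf.trans hg⟩

theorem IsContactomorphism.symm {α : ContactForm n M}
    {φ : M ≃ₘ^∞⟮𝓡 (2 * n + 1), 𝓡 (2 * n + 1)⟯ M} (hφ : IsContactomorphism α φ) :
    IsContactomorphism α φ.symm :=
  let ⟨_, hf⟩ := hφ
  ⟨_, hf.symm⟩

/-- The conformal factor of a contactomorphism is smooth. -/
theorem IsConformalFactor.contMDiff {α : ContactForm n M}
    {φ : M ≃ₘ^∞⟮𝓡 (2 * n + 1), 𝓡 (2 * n + 1)⟯ M} {f : M → ℝ} (hf : IsConformalFactor α φ f) :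
    ContMDiff (𝓡 (2 * n + 1)) 𝓘(ℝ, ℝ) ∞ f := by
  intro x
  obtain ⟨v, hv⟩ : ∃ v, α.form x v ≠ 0 := by
    by_contra! h
    exact α.ne_zero x (ContinuousLinearMap.ext h)
  -- With `v` extended to a field `V` smooth near `x`, one has `f = log α(dφ V) - log α(V)` near
  -- `x`. `Real.log` is `log |·|`, so only nonvanishing of `α(V)` matters, not its sign.
  set V : ∀ y : M, TangentSpace (𝓡 (2 * n + 1)) y := FiberBundle.extend (Model n) v with hV
  have hVx : V x = v := by simp [hV]
  have hVs : ContMDiffAt (𝓡 (2 * n + 1)) ((𝓡 (2 * n + 1)).prod 𝓘(ℝ, Model n)) ∞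
      (fun y => Bundle.TotalSpace.mk' (Model n) (E := (TangentSpace (𝓡 (2 * n + 1)) : M → Type _))
        y (V y)) x := FiberBundle.contMDiffAt_extend _ _ v
  have h1 : ContMDiffAt (𝓡 (2 * n + 1)) 𝓘(ℝ, ℝ) ∞ (fun y => α.form y (V y)) x := by
    have := (α.smooth x).clm_bundle_apply hVs
    exact (Bundle.contMDiffAt_totalSpace.1 this).2
  have hVs' : ContMDiffAt (𝓡 (2 * n + 1)) ((𝓡 (2 * n + 1)).prod 𝓘(ℝ, Model n)) ∞
      (fun y => Bundle.TotalSpace.mk' (Model n) (E := (TangentSpace (𝓡 (2 * n + 1)) : M → Type _))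
        (φ y) (mfderiv (𝓡 (2 * n + 1)) (𝓡 (2 * n + 1)) φ y (V y))) x :=
    ((φ.contMDiff.contMDiff_tangentMap (m := ∞) (by simp)) _).comp x hVs
  have h2 : ContMDiffAt (𝓡 (2 * n + 1)) 𝓘(ℝ, ℝ) ∞
      (fun y => α.form (φ y) (mfderiv (𝓡 (2 * n + 1)) (𝓡 (2 * n + 1)) φ y (V y))) x := by
    have := ContMDiffAt.clm_bundle_apply (F₂ := ℝ) (E₂ := Bundle.Trivial M ℝ)
      (ϕ := fun y => α.form (φ y)) ((α.smooth (φ x)).comp x (φ.contMDiff x)) hVs'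
    exact (Bundle.contMDiffAt_totalSpace.1 this).2
  have hne : α.form x (V x) ≠ 0 := by rwa [hVx]
  have hne' : α.form (φ x) (mfderiv (𝓡 (2 * n + 1)) (𝓡 (2 * n + 1)) φ x (V x)) ≠ 0 := by
    rw [hf x]
    exact mul_ne_zero (Real.exp_pos _).ne' hne
  have h3 : ContMDiffAt (𝓡 (2 * n + 1)) 𝓘(ℝ, ℝ) ∞ (fun y => Real.log
      (α.form (φ y) (mfderiv (𝓡 (2 * n + 1)) (𝓡 (2 * n + 1)) φ y (V y))) -
      Real.log (α.form y (V y))) x :=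
    ((Real.contDiffAt_log.2 hne').contMDiffAt.comp x h2).sub
      ((Real.contDiffAt_log.2 hne).contMDiffAt.comp x h1)
  refine h3.congr_of_eventuallyEq ?_
  filter_upwards [h1.continuousAt.eventually_ne hne] with y hy
  rw [hf y, Real.log_mul (Real.exp_pos _).ne' hy, Real.log_exp, add_sub_cancel_right]

/-! ### Contact isotopies: support of the Hamiltonian, and operations on isotopies. -/

namespace IsContactIsotopy

variable {α : ContactForm n M} {φ ψ : ℝ → M ≃ₘ^∞⟮𝓡 (2 * n + 1), 𝓡 (2 * n + 1)⟯ M}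
  {G H : ℝ → M → ℝ}

theorem mdifferentiableWithinAt (h : IsContactIsotopy α φ H) (x : M) {t : ℝ}
    (ht : t ∈ Icc (0 : ℝ) 1) :
    MDifferentiableWithinAt 𝓘(ℝ, ℝ) (𝓡 (2 * n + 1)) (fun s => φ s x) (Icc 0 1) t :=
  ((h.smooth.comp (contMDiffOn_id.prodMk contMDiffOn_const)
    (fun _ hs => ⟨hs, mem_univ _⟩)).mdifferentiableOn (by simp)) t ht

theorem speed_eq (h : IsContactIsotopy α φ H) (x : M) {t : ℝ} (ht : t ∈ Icc (0 : ℝ) 1) :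
    speed α (fun s => φ s x) t = H t (φ t x) :=
  h.hamiltonian t ht x

/-- A point outside `K` never moves, so its trajectory has zero velocity. -/
theorem hamiltonian_eq_zero (h : IsContactIsotopy α φ H) {K : Set M}
    (hK : ∀ t ∈ Icc (0 : ℝ) 1, ∀ x ∉ K, φ t x = x) {t : ℝ} (ht : t ∈ Icc (0 : ℝ) 1) {x : M}
    (hx : x ∉ K) : H t x = 0 := by
  have h1 := h.speed_eq x ht
  rw [hK t ht x hx] at h1
  rw [← h1, ← speed_const α x t]
  exact speed_congr α ht (eventually_mem_nhdsWithin.mono fun s hs => hK s hs x hx)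

theorem bddAbove (h : IsContactIsotopy α φ H) {t : ℝ} (ht : t ∈ Icc (0 : ℝ) 1) :
    BddAbove (range fun x => |H t x|) := by
  obtain ⟨K, hK, hφ⟩ := h.compactSupport
  have hc : Continuous (H t) := (h.smooth_hamiltonian.continuousOn.comp_continuous
    (Continuous.prodMk_right t) fun x => ⟨ht, mem_univ x⟩)
  obtain ⟨C, hC⟩ := hK.bddAbove_image hc.abs.continuousOn
  refine ⟨max C 0, ?_⟩
  rintro _ ⟨x, rfl⟩
  by_cases hx : x ∈ K
  · exact le_max_of_le_left (hC (mem_image_of_mem _ hx))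
  · simp [h.hamiltonian_eq_zero hφ ht hx]

/-- The Hamiltonian vanishes off a compact set, so the supremum may be taken over a compact set,
where it depends continuously on the parameter. -/
theorem continuousOn_iSup [Nonempty M] (h : IsContactIsotopy α φ H) :
    ContinuousOn (fun t => ⨆ x, |H t x|) (Icc 0 1) := by
  obtain ⟨K, hK, hφ⟩ := h.compactSupport
  rw [continuousOn_iff_continuous_domRestrict]
  -- `K` may be empty; adjoining a point keeps it compact and makes the supremum one over a nonempty
  -- set.
  let x₀ : M := Classical.arbitrary M
  have hc : Continuous fun p : Icc (0 : ℝ) 1 × M => |H p.1 p.2| :=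
    (h.smooth_hamiltonian.continuousOn.comp_continuous
      (f := fun p : Icc (0 : ℝ) 1 × M => ((p.1 : ℝ), p.2)) (by fun_prop)
      fun p => ⟨p.1.2, mem_univ _⟩).abs
  have hs := (hK.insert x₀).continuous_sSup (f := fun (t : Icc (0 : ℝ) 1) x => |H t x|) hc
  refine hs.congr fun t => ?_
  have hb := h.bddAbove t.2
  have hne : ((fun x => |H t x|) '' insert x₀ K).Nonempty := (insert_nonempty x₀ K).image _
  refine le_antisymm (csSup_le hne ?_) (ciSup_le fun x => ?_)
  · rintro _ ⟨x, -, rfl⟩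
    exact le_ciSup hb x
  · have hle : ∀ y ∈ insert x₀ K, |H t y| ≤ sSup ((fun x => |H t x|) '' insert x₀ K) :=
      fun y hy => le_csSup (hb.mono (image_subset_range _ _)) (mem_image_of_mem _ hy)
    by_cases hx : x ∈ K
    · exact hle x (mem_insert_of_mem _ hx)
    · rw [h.hamiltonian_eq_zero hφ t.2 hx, abs_zero]
      exact (abs_nonneg _).trans (hle x₀ (mem_insert _ _))

/-- The constant isotopy. -/
theorem refl (α : ContactForm n M) :
    IsContactIsotopy α (fun _ => Diffeomorph.refl (𝓡 (2 * n + 1)) M ∞) (fun _ _ => 0) where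
  start _ := rfl
  smooth := contMDiffOn_snd
  contact _ _ := IsContactomorphism.refl α
  compactSupport := ⟨∅, isCompact_empty, fun _ _ _ _ => rfl⟩
  smooth_hamiltonian := contMDiffOn_const
  hamiltonian t _ x := speed_const α x t

/-- The isotopy run backwards, normalised to start at the identity. -/
theorem reverse (h : IsContactIsotopy α φ H) :
    IsContactIsotopy α (fun t => (φ 1).symm.trans (φ (1 - t))) (fun t x => -H (1 - t) x) := by
  have hmem : ∀ t ∈ Icc (0 : ℝ) 1, 1 - t ∈ Icc (0 : ℝ) 1 := fun t ht =>
    ⟨sub_nonneg.2 ht.2, sub_le_self _ ht.1⟩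
  have hrev : ContMDiff 𝓘(ℝ, ℝ) 𝓘(ℝ, ℝ) ∞ (fun t : ℝ => 1 - t) :=
    (contDiff_const.sub contDiff_id).contMDiff
  obtain ⟨K, hK, hφ⟩ := h.compactSupport
  refine ⟨fun x => by simp, ?_, fun t ht => ?_, ⟨K, hK, fun t ht x hx => ?_⟩, ?_, fun t ht x => ?_⟩
  · exact h.smooth.comp ((hrev.comp contMDiff_fst).prodMk
      ((φ 1).symm.contMDiff.comp contMDiff_snd)).contMDiffOn
      (fun p hp => ⟨hmem _ hp.1, mem_univ _⟩)
  · exact (h.contact 1 (by simp)).symm.trans (h.contact _ (hmem t ht))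
  · have h1 : (φ 1).symm x = x := by
      conv_lhs => rw [← hφ 1 (by simp) x hx]
      exact (φ 1).symm_apply_apply x
    simp [h1, hφ _ (hmem t ht) x hx]
  · exact (h.smooth_hamiltonian.comp ((hrev.comp contMDiff_fst).prodMk contMDiff_snd).contMDiffOn
      (fun p hp => ⟨hmem _ hp.1, mem_univ _⟩)).neg
  · refine (speed_comp α (c := fun s => φ s ((φ 1).symm x)) (χ' := -1) ht (fun s hs => hmem s hs)
      ((hasDerivAt_id t).const_sub 1) (h.mdifferentiableWithinAt _ (hmem t ht))).trans ?_
    rw [h.speed_eq _ (hmem t ht)]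
    simp

theorem smoothTransition_contDiff : ContDiff ℝ ∞ Real.smoothTransition :=
  Real.smoothTransition.contDiff

/-- The concatenation of two isotopies, reparametrised so as to be stationary where they meet. -/
theorem concat (hψ : IsContactIsotopy α ψ G) (hφ : IsContactIsotopy α φ H) :
    IsContactIsotopy α
      (fun t => (ψ (Real.smoothTransition (3 * t))).trans (φ (Real.smoothTransition (3 * t - 2))))
      (fun t x => deriv (fun s => Real.smoothTransition (3 * s)) t *
          G (Real.smoothTransition (3 * t)) x +
        deriv (fun s => Real.smoothTransition (3 * s - 2)) t *
          H (Real.smoothTransition (3 * t - 2)) x) := by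
  -- `χ` climbs from 0 to 1 on `[0, 1/3]` and `η` on `[2/3, 1]`.
  set χ : ℝ → ℝ := fun t => Real.smoothTransition (3 * t) with hχ
  set η : ℝ → ℝ := fun t => Real.smoothTransition (3 * t - 2) with hη
  have hχI : ∀ t, χ t ∈ Icc (0 : ℝ) 1 := fun t =>
    ⟨Real.smoothTransition.nonneg _, Real.smoothTransition.le_one _⟩
  have hηI : ∀ t, η t ∈ Icc (0 : ℝ) 1 := fun t =>
    ⟨Real.smoothTransition.nonneg _, Real.smoothTransition.le_one _⟩
  have hχd : ContDiff ℝ ∞ χ := smoothTransition_contDiff.comp (by fun_prop)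
  have hηd : ContDiff ℝ ∞ η := smoothTransition_contDiff.comp (by fun_prop)
  have hχ' := (contDiff_infty_iff_deriv.1 hχd).2
  have hη' := (contDiff_infty_iff_deriv.1 hηd).2
  have hψs : ContMDiffOn (𝓘(ℝ, ℝ).prod (𝓡 (2 * n + 1))) (𝓡 (2 * n + 1)) ∞
      (fun p : ℝ × M => ψ (χ p.1) p.2) (Icc 0 1 ×ˢ univ) :=
    hψ.smooth.comp ((hχd.contMDiff.comp contMDiff_fst).prodMk contMDiff_snd).contMDiffOn
      (fun p _ => ⟨hχI _, mem_univ _⟩)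
  obtain ⟨K₁, hK₁, hψK⟩ := hψ.compactSupport
  obtain ⟨K₂, hK₂, hφK⟩ := hφ.compactSupport
  refine ⟨fun x => ?_, ?_, fun t ht => ?_, ⟨K₁ ∪ K₂, hK₁.union hK₂, fun t ht x hx => ?_⟩, ?_,
    fun t ht x => ?_⟩
  · have h1 : χ 0 = 0 := by simp [hχ]
    have h2 : η 0 = 0 := Real.smoothTransition.zero_of_nonpos (by norm_num)
    change φ (η 0) (ψ (χ 0) x) = x
    rw [h1, h2, hψ.start, hφ.start]
  · exact hφ.smooth.comp ((hηd.contMDiff.comp contMDiff_fst).contMDiffOn.prodMk hψs)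
      (fun p _ => ⟨hηI _, mem_univ _⟩)
  · exact (hψ.contact _ (hχI t)).trans (hφ.contact _ (hηI t))
  · rw [mem_union, not_or] at hx
    change φ (η t) (ψ (χ t) x) = x
    rw [hψK _ (hχI t) x hx.1, hφK _ (hηI t) x hx.2]
  · refine ContMDiffOn.add (ContMDiffOn.mul (hχ'.contMDiff.comp contMDiff_fst).contMDiffOn ?_)
      (ContMDiffOn.mul (hη'.contMDiff.comp contMDiff_fst).contMDiffOn ?_)
    · exact hψ.smooth_hamiltonian.comp
        ((hχd.contMDiff.comp contMDiff_fst).prodMk contMDiff_snd).contMDiffOn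
        (fun p _ => ⟨hχI _, mem_univ _⟩)
    · exact hφ.smooth_hamiltonian.comp
        ((hηd.contMDiff.comp contMDiff_fst).prodMk contMDiff_snd).contMDiffOn
        (fun p _ => ⟨hηI _, mem_univ _⟩)
  · change speed α (fun s => φ (η s) (ψ (χ s) x)) t = deriv χ t * G (χ t) (φ (η t) (ψ (χ t) x)) +
      deriv η t * H (η t) (φ (η t) (ψ (χ t) x))
    have hχt := (hχd.differentiable (by simp) t).hasDerivAt
    have hηt := (hηd.differentiable (by simp) t).hasDerivAt
    -- Near each time one of `χ`, `η` is constant, so only one isotopy moves. Hence no conformal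
    -- factor enters the Hamiltonian of the composite.
    rcases lt_or_ge t (2 / 3) with hlt | hge
    · have hη0 : η =ᶠ[𝓝 t] fun _ => 0 := by
        filter_upwards [gt_mem_nhds hlt] with s hs
        exact Real.smoothTransition.zero_of_nonpos (by linarith)
      have hcurve : (fun s => φ (η s) (ψ (χ s) x)) =ᶠ[𝓝[Icc 0 1] t] fun s => ψ (χ s) x :=
        (hη0.filter_mono nhdsWithin_le_nhds).mono fun s hs => by
          simp only [hs]
          exact hφ.start _
      rw [speed_congr α ht hcurve, speed_comp α (c := fun s => ψ s x) ht (fun s _ => hχI s) hχt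
        (hψ.mdifferentiableWithinAt x (hχI t)), hψ.speed_eq x (hχI t), hη0.deriv_eq, hη0.eq_of_nhds,
        deriv_const, hφ.start]
      ring
    · have hχ1 : χ =ᶠ[𝓝 t] fun _ => 1 := by
        filter_upwards [lt_mem_nhds (show (1 / 3 : ℝ) < t by linarith)] with s hs
        exact Real.smoothTransition.one_of_one_le (by linarith)
      have hcurve : (fun s => φ (η s) (ψ (χ s) x)) =ᶠ[𝓝[Icc 0 1] t] fun s => φ (η s) (ψ 1 x) :=
        (hχ1.filter_mono nhdsWithin_le_nhds).mono fun s hs => by simp only [hs]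
      rw [speed_congr α ht hcurve, speed_comp α (c := fun s => φ s (ψ 1 x)) ht (fun s _ => hηI s)
        hηt (hφ.mdifferentiableWithinAt _ (hηI t)), hφ.speed_eq _ (hηI t), hχ1.deriv_eq,
        hχ1.eq_of_nhds, deriv_const]
      ring

/-- The conjugate of an isotopy by a contactomorphism. -/
theorem conj (h : IsContactIsotopy α φ H) {θ : M ≃ₘ^∞⟮𝓡 (2 * n + 1), 𝓡 (2 * n + 1)⟯ M} {f : M → ℝ}
    (hf : IsConformalFactor α θ f) :
    IsContactIsotopy α (fun t => (θ.symm.trans (φ t)).trans θ)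
      (fun t x => Real.exp (f (θ.symm x)) * H t (θ.symm x)) := by
  obtain ⟨K, hK, hφ⟩ := h.compactSupport
  have hθ : ContMDiff (𝓘(ℝ, ℝ).prod (𝓡 (2 * n + 1))) (𝓡 (2 * n + 1)) ∞
      (fun p : ℝ × M => θ.symm p.2) := θ.symm.contMDiff.comp contMDiff_snd
  refine ⟨fun x => by simp [h.start], ?_, fun t ht => ?_,
    ⟨θ '' K, hK.image θ.continuous, fun t ht x hx => ?_⟩, ?_, fun t ht x => ?_⟩
  · exact θ.contMDiff.comp_contMDiffOn
      (h.smooth.comp (contMDiff_fst.prodMk hθ).contMDiffOn (fun p hp => ⟨hp.1, mem_univ _⟩))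
  · have hθc : IsContactomorphism α θ := ⟨f, hf⟩
    exact (hθc.symm.trans (h.contact t ht)).trans hθc
  · have hx' : θ.symm x ∉ K := fun hx' => hx ⟨_, hx', θ.apply_symm_apply x⟩
    simp [hφ t ht _ hx']
  · exact ContMDiffOn.mul
      (Real.contDiff_exp.contMDiff.comp (hf.contMDiff.comp hθ)).contMDiffOn
      (h.smooth_hamiltonian.comp (contMDiff_fst.prodMk hθ).contMDiffOn
        (fun p hp => ⟨hp.1, mem_univ _⟩))
  · refine (hf.speed_comp ht (h.mdifferentiableWithinAt (θ.symm x) ht)).trans ?_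
    rw [h.speed_eq _ ht]
    simp

/-! ### Lengths of isotopies -/

theorem intervalIntegrable_iSup [Nonempty M] (h : IsContactIsotopy α φ H) :
    IntervalIntegrable (fun t => ⨆ x, |H t x|) MeasureTheory.volume 0 1 :=
  ContinuousOn.intervalIntegrable_of_Icc zero_le_one h.continuousOn_iSup

/-- The length of an isotopy is invariant under monotone reparametrisation. -/
theorem integral_reparam [Nonempty M] (h : IsContactIsotopy α φ H) {χ : ℝ → ℝ}
    (hχ : ContDiff ℝ ∞ χ) (hχI : ∀ t, χ t ∈ Icc (0 : ℝ) 1) (h0 : χ 0 = 0) (h1 : χ 1 = 1) :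
    ∫ t in (0 : ℝ)..1, (⨆ x, |H (χ t) x|) * deriv χ t = ∫ t in (0 : ℝ)..1, ⨆ x, |H t x| := by
  have := intervalIntegral.integral_comp_mul_deriv' (a := 0) (b := 1) (f := χ) (f' := deriv χ)
    (g := fun t => ⨆ x, |H t x|) (fun t _ => (hχ.differentiable (by simp) t).hasDerivAt)
    (contDiff_infty_iff_deriv.1 hχ).2.continuous.continuousOn
    (h.continuousOn_iSup.mono (by rintro _ ⟨t, -, rfl⟩; exact hχI t))
  rw [h0, h1] at this
  exact this

/-- Since `χ', η' ≥ 0`, the supremum of the new Hamiltonian is at most `χ' max|G_χ| + η' max|H_η|`;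
substitution turns the two integrals into the original lengths. -/
theorem integral_concat_le [Nonempty M] (hψ : IsContactIsotopy α ψ G)
    (hφ : IsContactIsotopy α φ H) :
    (∫ t in (0 : ℝ)..1, ⨆ x, |deriv (fun s => Real.smoothTransition (3 * s)) t *
          G (Real.smoothTransition (3 * t)) x +
        deriv (fun s => Real.smoothTransition (3 * s - 2)) t *
          H (Real.smoothTransition (3 * t - 2)) x|) ≤
      (∫ t in (0 : ℝ)..1, ⨆ x, |G t x|) + ∫ t in (0 : ℝ)..1, ⨆ x, |H t x| := by
  have hint := (hψ.concat hφ).intervalIntegrable_iSup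
  set χ : ℝ → ℝ := fun t => Real.smoothTransition (3 * t) with hχ
  set η : ℝ → ℝ := fun t => Real.smoothTransition (3 * t - 2) with hη
  have hχI : ∀ t, χ t ∈ Icc (0 : ℝ) 1 := fun t =>
    ⟨Real.smoothTransition.nonneg _, Real.smoothTransition.le_one _⟩
  have hηI : ∀ t, η t ∈ Icc (0 : ℝ) 1 := fun t =>
    ⟨Real.smoothTransition.nonneg _, Real.smoothTransition.le_one _⟩
  have hχd : ContDiff ℝ ∞ χ := smoothTransition_contDiff.comp (by fun_prop)
  have hηd : ContDiff ℝ ∞ η := smoothTransition_contDiff.comp (by fun_prop)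
  have hχ' := (contDiff_infty_iff_deriv.1 hχd).2.continuous
  have hη' := (contDiff_infty_iff_deriv.1 hηd).2.continuous
  have hχm : ∀ t, 0 ≤ deriv χ t := fun t => Monotone.deriv_nonneg
    (fun a b hab => Real.smoothTransition.monotone (by linarith))
  have hηm : ∀ t, 0 ≤ deriv η t := fun t => Monotone.deriv_nonneg
    (fun a b hab => Real.smoothTransition.monotone (by linarith))
  have hGi : IntervalIntegrable (fun t => (⨆ x, |G (χ t) x|) * deriv χ t)
      MeasureTheory.volume 0 1 :=
    ((hψ.continuousOn_iSup.comp_continuous hχd.continuous hχI).mul hχ').intervalIntegrable _ _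
  have hHi : IntervalIntegrable (fun t => (⨆ x, |H (η t) x|) * deriv η t)
      MeasureTheory.volume 0 1 :=
    ((hφ.continuousOn_iSup.comp_continuous hηd.continuous hηI).mul hη').intervalIntegrable _ _
  rw [← hψ.integral_reparam hχd hχI (by simp [hχ])
      (Real.smoothTransition.one_of_one_le (by norm_num)),
    ← hφ.integral_reparam hηd hηI (Real.smoothTransition.zero_of_nonpos (by norm_num))
      (Real.smoothTransition.one_of_one_le (by norm_num)),
    ← intervalIntegral.integral_add hGi hHi]
  refine intervalIntegral.integral_mono_on zero_le_one hint (hGi.add hHi) fun t _ => ?_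
  refine ciSup_le fun x => (abs_add_le _ _).trans ?_
  rw [abs_mul, abs_mul, abs_of_nonneg (hχm t), abs_of_nonneg (hηm t), mul_comm, mul_comm (deriv η t)]
  exact add_le_add (mul_le_mul_of_nonneg_right (le_ciSup (hψ.bddAbove (hχI t)) x) (hχm t))
    (mul_le_mul_of_nonneg_right (le_ciSup (hφ.bddAbove (hηI t)) x) (hηm t))

theorem integral_conj_le [Nonempty M] (h : IsContactIsotopy α φ H)
    {θ : M ≃ₘ^∞⟮𝓡 (2 * n + 1), 𝓡 (2 * n + 1)⟯ M} {f : M → ℝ} (hf : IsConformalFactor α θ f)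
    {C : ℝ} (hC : ∀ x, Real.exp (f x) ≤ C) :
    (∫ t in (0 : ℝ)..1, ⨆ x, |Real.exp (f (θ.symm x)) * H t (θ.symm x)|) ≤
      C * ∫ t in (0 : ℝ)..1, ⨆ x, |H t x| := by
  rw [← intervalIntegral.integral_const_mul]
  refine intervalIntegral.integral_mono_on zero_le_one (h.conj hf).intervalIntegrable_iSup
    (h.intervalIntegrable_iSup.const_mul C) fun t ht => ciSup_le fun x => ?_
  rw [abs_mul, Real.abs_exp]
  exact mul_le_mul (hC _) (le_ciSup (h.bddAbove ht) (θ.symm x)) (abs_nonneg _)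
    ((Real.exp_pos _).le.trans (hC (θ.symm x)))

end IsContactIsotopy

/-! ### Generated contactomorphisms -/

variable {α : ContactForm n M}
  {φ ψ θ : M ≃ₘ^∞⟮𝓡 (2 * n + 1), 𝓡 (2 * n + 1)⟯ M} {G H : ℝ → M → ℝ} {f : M → ℝ}

theorem IsGeneratedBy.isContactomorphism (h : IsGeneratedBy α φ H) : IsContactomorphism α φ := by
  obtain ⟨Φ, hΦ, rfl⟩ := h
  exact hΦ.contact 1 (by simp)

theorem isGeneratedBy_refl (α : ContactForm n M) :
    IsGeneratedBy α (Diffeomorph.refl (𝓡 (2 * n + 1)) M ∞) (fun _ _ => 0) :=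
  ⟨_, IsContactIsotopy.refl α, rfl⟩

theorem IsGeneratedBy.symm (h : IsGeneratedBy α φ H) :
    IsGeneratedBy α φ.symm (fun t x => -H (1 - t) x) := by
  obtain ⟨Φ, hΦ, rfl⟩ := h
  refine ⟨_, hΦ.reverse, Diffeomorph.ext fun x => ?_⟩
  simp [hΦ.start]

theorem IsGeneratedBy.trans (hψ : IsGeneratedBy α ψ G) (hφ : IsGeneratedBy α φ H) :
    IsGeneratedBy α (ψ.trans φ)
      (fun t x => deriv (fun s => Real.smoothTransition (3 * s)) t *
          G (Real.smoothTransition (3 * t)) x +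
        deriv (fun s => Real.smoothTransition (3 * s - 2)) t *
          H (Real.smoothTransition (3 * t - 2)) x) := by
  obtain ⟨Ψ, hΨ, rfl⟩ := hψ
  obtain ⟨Φ, hΦ, rfl⟩ := hφ
  refine ⟨_, hΨ.concat hΦ, ?_⟩
  rw [Real.smoothTransition.one_of_one_le (show (1 : ℝ) ≤ 3 * 1 by norm_num),
    Real.smoothTransition.one_of_one_le (show (1 : ℝ) ≤ 3 * 1 - 2 by norm_num)]

theorem IsGeneratedBy.conj (h : IsGeneratedBy α φ H) (hf : IsConformalFactor α θ f) :
    IsGeneratedBy α ((θ.symm.trans φ).trans θ)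
      (fun t x => Real.exp (f (θ.symm x)) * H t (θ.symm x)) := by
  obtain ⟨Φ, hΦ, rfl⟩ := h
  exact ⟨_, hΦ.conj hf, rfl⟩

/-! ### The group of contactomorphisms isotopic to the identity -/

theorem refl_mem_cont₀ (α : ContactForm n M) :
    Diffeomorph.refl (𝓡 (2 * n + 1)) M ∞ ∈ Cont₀ α :=
  ⟨_, isGeneratedBy_refl α⟩

theorem symm_mem_cont₀ (h : φ ∈ Cont₀ α) : φ.symm ∈ Cont₀ α :=
  let ⟨_, hH⟩ := h
  ⟨_, hH.symm⟩

theorem trans_mem_cont₀ (hψ : ψ ∈ Cont₀ α) (hφ : φ ∈ Cont₀ α) : ψ.trans φ ∈ Cont₀ α :=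
  let ⟨_, hG⟩ := hψ
  let ⟨_, hH⟩ := hφ
  ⟨_, hG.trans hH⟩

theorem conj_mem_cont₀ (h : φ ∈ Cont₀ α) (hf : IsConformalFactor α θ f) :
    (θ.symm.trans φ).trans θ ∈ Cont₀ α :=
  let ⟨_, hH⟩ := h
  ⟨_, hH.conj hf⟩

/-! ### Shelukhin's norm -/

theorem integral_iSup_abs_nonneg {X : Type*} (H : ℝ → X → ℝ) : 0 ≤ ∫ t in (0 : ℝ)..1, ⨆ x, |H t x| :=
  intervalIntegral.integral_nonneg zero_le_one fun _ _ => Real.iSup_nonneg fun _ => abs_nonneg _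

theorem shelukhinNorm_nonneg (α : ContactForm n M)
    (φ : M ≃ₘ^∞⟮𝓡 (2 * n + 1), 𝓡 (2 * n + 1)⟯ M) : 0 ≤ shelukhinNorm α φ := by
  refine Real.sInf_nonneg ?_
  rintro _ ⟨H, -, rfl⟩
  exact integral_iSup_abs_nonneg H

theorem IsGeneratedBy.shelukhinNorm_le (h : IsGeneratedBy α φ H) :
    shelukhinNorm α φ ≤ ∫ t in (0 : ℝ)..1, ⨆ x, |H t x| := by
  refine csInf_le ⟨0, ?_⟩ ⟨H, h, rfl⟩
  rintro _ ⟨H, -, rfl⟩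
  exact integral_iSup_abs_nonneg H

/-- In `ℝ` the infimum of the empty set is 0, so a lower bound needs some generating Hamiltonian;
membership in `Cont₀` supplies it. -/
theorem le_shelukhinNorm (hφ : φ ∈ Cont₀ α) {c : ℝ}
    (h : ∀ H, IsGeneratedBy α φ H → c ≤ ∫ t in (0 : ℝ)..1, ⨆ x, |H t x|) :
    c ≤ shelukhinNorm α φ := by
  obtain ⟨H, hH⟩ := hφ
  refine le_csInf ⟨_, H, hH, rfl⟩ ?_
  rintro _ ⟨H, hH, rfl⟩
  exact h H hH

theorem shelukhinNorm_refl (α : ContactForm n M) :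
    shelukhinNorm α (Diffeomorph.refl (𝓡 (2 * n + 1)) M ∞) = 0 :=
  le_antisymm ((isGeneratedBy_refl α).shelukhinNorm_le.trans (by simp)) (shelukhinNorm_nonneg _ _)

theorem shelukhinNorm_symm_le (hφ : φ ∈ Cont₀ α) :
    shelukhinNorm α φ.symm ≤ shelukhinNorm α φ := by
  refine le_shelukhinNorm hφ fun H hH => hH.symm.shelukhinNorm_le.trans_eq ?_
  -- The substitution `t ↦ 1 - t` identifies the two lengths.
  have h := intervalIntegral.integral_comp_sub_left (a := 0) (b := 1)
    (fun t => ⨆ x, |H t x|) (1 : ℝ)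
  rw [sub_self, sub_zero] at h
  simpa only [abs_neg] using h

theorem shelukhinNorm_trans_le [Nonempty M] (hψ : ψ ∈ Cont₀ α) (hφ : φ ∈ Cont₀ α) :
    shelukhinNorm α (ψ.trans φ) ≤ shelukhinNorm α ψ + shelukhinNorm α φ := by
  -- Moving one summand across at a time lets the two infima be taken separately.
  rw [← sub_le_iff_le_add]
  refine le_shelukhinNorm hψ fun G hG => ?_
  rw [sub_le_comm]
  refine le_shelukhinNorm hφ fun H hH => ?_
  rw [sub_le_iff_le_add']
  refine (hG.trans hH).shelukhinNorm_le.trans ?_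
  obtain ⟨Ψ, hΨ, -⟩ := hG
  obtain ⟨Φ, hΦ, -⟩ := hH
  exact hΨ.integral_concat_le hΦ

theorem shelukhinNorm_conj_le [Nonempty M] (hφ : φ ∈ Cont₀ α) (hf : IsConformalFactor α θ f)
    {C : ℝ} (hC : ∀ x, Real.exp (f x) ≤ C) :
    shelukhinNorm α ((θ.symm.trans φ).trans θ) ≤ C * shelukhinNorm α φ := by
  have hC0 : 0 < C := (Real.exp_pos _).trans_le (hC (Classical.arbitrary M))
  rw [← div_le_iff₀' hC0]
  refine le_shelukhinNorm hφ fun H hH => ?_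
  rw [div_le_iff₀' hC0]
  refine (hH.conj hf).shelukhinNorm_le.trans ?_
  obtain ⟨Φ, hΦ, -⟩ := hH
  exact hΦ.integral_conj_le hf hC

/-! ### The pseudo-metric on orbits -/

variable {L₁ L₂ L₃ N : Set M}

theorem exists_cont₀_image_eq (h₁ : L₁ ∈ orbitSpace α N) (h₂ : L₂ ∈ orbitSpace α N) :
    ∃ φ ∈ Cont₀ α, φ '' L₁ = L₂ := by
  obtain ⟨φ₁, hφ₁, rfl⟩ := h₁
  obtain ⟨φ₂, hφ₂, rfl⟩ := h₂
  refine ⟨_, trans_mem_cont₀ (symm_mem_cont₀ hφ₁) hφ₂, ?_⟩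
  rw [image_image]
  simp

theorem image_mem_orbitSpace (hφ : φ ∈ Cont₀ α) (h : L₁ ∈ orbitSpace α N) :
    φ '' L₁ ∈ orbitSpace α N := by
  obtain ⟨φ₁, hφ₁, rfl⟩ := h
  exact ⟨_, trans_mem_cont₀ hφ₁ hφ, by rw [image_image]; rfl⟩

theorem alphaMetric_nonneg (α : ContactForm n M) (L₁ L₂ : Set M) : 0 ≤ alphaMetric α L₁ L₂ := by
  refine Real.sInf_nonneg ?_
  rintro _ ⟨φ, -, -, rfl⟩
  exact shelukhinNorm_nonneg _ _

theorem alphaMetric_le (hφ : φ ∈ Cont₀ α) (h : φ '' L₁ = L₂) :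
    alphaMetric α L₁ L₂ ≤ shelukhinNorm α φ := by
  refine csInf_le ⟨0, ?_⟩ ⟨φ, hφ, h, rfl⟩
  rintro _ ⟨φ, -, -, rfl⟩
  exact shelukhinNorm_nonneg _ _

/-- Membership in a common orbit makes the set under the infimum nonempty. -/
theorem le_alphaMetric (h₁ : L₁ ∈ orbitSpace α N) (h₂ : L₂ ∈ orbitSpace α N) {c : ℝ}
    (h : ∀ φ ∈ Cont₀ α, φ '' L₁ = L₂ → c ≤ shelukhinNorm α φ) : c ≤ alphaMetric α L₁ L₂ := by
  obtain ⟨φ, hφ, hL⟩ := exists_cont₀_image_eq h₁ h₂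
  refine le_csInf ⟨_, φ, hφ, hL, rfl⟩ ?_
  rintro _ ⟨φ, hφ, hL, rfl⟩
  exact h φ hφ hL

theorem alphaMetric_self (α : ContactForm n M) (L : Set M) : alphaMetric α L L = 0 :=
  le_antisymm ((alphaMetric_le (refl_mem_cont₀ α) (image_id L)).trans_eq (shelukhinNorm_refl α))
    (alphaMetric_nonneg α L L)

theorem alphaMetric_comm_le (h₁ : L₁ ∈ orbitSpace α N) (h₂ : L₂ ∈ orbitSpace α N) :
    alphaMetric α L₁ L₂ ≤ alphaMetric α L₂ L₁ :=
  le_alphaMetric h₂ h₁ fun _ hφ hL =>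
    (alphaMetric_le (symm_mem_cont₀ hφ) (diffeomorph_symm_image_eq hL)).trans (shelukhinNorm_symm_le hφ)

theorem alphaMetric_triangle [Nonempty M] (h₁ : L₁ ∈ orbitSpace α N) (h₂ : L₂ ∈ orbitSpace α N)
    (h₃ : L₃ ∈ orbitSpace α N) :
    alphaMetric α L₁ L₃ ≤ alphaMetric α L₁ L₂ + alphaMetric α L₂ L₃ := by
  rw [← sub_le_iff_le_add]
  refine le_alphaMetric h₁ h₂ fun ψ hψ hL => ?_
  rw [sub_le_comm]
  refine le_alphaMetric h₂ h₃ fun φ hφ hL' => ?_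
  rw [sub_le_iff_le_add']
  refine (alphaMetric_le (trans_mem_cont₀ hψ hφ) ?_).trans (shelukhinNorm_trans_le hψ hφ)
  rw [← hL', ← hL, image_image]
  rfl

/-- Conjugation by `θ` turns a map taking `L₁` to `L₂` into one taking `θ(L₁)` to `θ(L₂)`. Here `θ`
may be any contactomorphism, not necessarily isotopic to the identity. -/
theorem alphaMetric_image_le [Nonempty M] (h₁ : L₁ ∈ orbitSpace α N) (h₂ : L₂ ∈ orbitSpace α N)
    (hf : IsConformalFactor α θ f) {C : ℝ} (hC : ∀ x, Real.exp (f x) ≤ C) :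
    alphaMetric α (θ '' L₁) (θ '' L₂) ≤ C * alphaMetric α L₁ L₂ := by
  have hC0 : 0 < C := (Real.exp_pos _).trans_le (hC (Classical.arbitrary M))
  rw [← div_le_iff₀' hC0]
  refine le_alphaMetric h₁ h₂ fun φ hφ hL => ?_
  rw [div_le_iff₀' hC0]
  refine (alphaMetric_le (conj_mem_cont₀ hφ hf) ?_).trans (shelukhinNorm_conj_le hφ hf hC)
  rw [← hL, image_image, image_image]
  simp

/-- This is the upper bound for `θ⁻¹`, whose conformal factor is `-f ∘ θ⁻¹`. The images must lie in
the orbit for that bound to apply, whence `θ ∈ Cont₀`. -/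
theorem le_alphaMetric_image [Nonempty M] (hθ : θ ∈ Cont₀ α) (h₁ : L₁ ∈ orbitSpace α N)
    (h₂ : L₂ ∈ orbitSpace α N) (hf : IsConformalFactor α θ f) {C : ℝ} (hC0 : 0 < C)
    (hC : ∀ x, C ≤ Real.exp (f x)) :
    C * alphaMetric α L₁ L₂ ≤ alphaMetric α (θ '' L₁) (θ '' L₂) := by
  have h := alphaMetric_image_le (image_mem_orbitSpace hθ h₁) (image_mem_orbitSpace hθ h₂) hf.symm
    (C := C⁻¹) fun x => by
      rw [Real.exp_neg]
      exact inv_anti₀ hC0 (hC _)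
  rwa [diffeomorph_symm_image_eq rfl, diffeomorph_symm_image_eq rfl, ← div_eq_inv_mul, le_div_iff₀' hC0] at h

/-! ### Compact support of conformal factors -/

/-- The derivative of `φ` at `x` is the identity, so `α = e^f α` there, and `α` does not vanish. -/
theorem IsConformalFactor.eq_zero_of_eventuallyEq (hf : IsConformalFactor α φ f) {x : M}
    (h : φ =ᶠ[𝓝 x] id) : f x = 0 := by
  obtain ⟨v, hv⟩ : ∃ v, α.form x v ≠ 0 := by
    by_contra! h
    exact α.ne_zero x (ContinuousLinearMap.ext h)
  have hd : (mfderiv (𝓡 (2 * n + 1)) (𝓡 (2 * n + 1)) φ x : Model n →L[ℝ] Model n) =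
      ContinuousLinearMap.id ℝ (Model n) :=
    h.mfderiv_eq.trans mfderiv_id
  have key : ∀ (y : M) (w : Model n), y = x →
      (α.form y : Model n → ℝ) w = (α.form x : Model n → ℝ) w := by
    rintro y w rfl
    rfl
  have h1 : α.form x v = Real.exp (f x) * α.form x v :=
    ((key _ _ h.eq_of_nhds).symm.trans (congrArg (fun A : Model n →L[ℝ] Model n =>
      (α.form (φ x) : Model n → ℝ) (A v)) hd).symm).trans (hf x v)
  exact Real.exp_eq_one_iff _ |>.1 ((right_eq_mul₀ hv).1 h1)

theorem IsConformalFactor.hasCompactSupport [T2Space M] (hφ : φ ∈ Cont₀ α)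
    (hf : IsConformalFactor α φ f) : HasCompactSupport f := by
  obtain ⟨H, Φ, hΦ, rfl⟩ := hφ
  obtain ⟨K, hK, hΦK⟩ := hΦ.compactSupport
  refine HasCompactSupport.intro hK fun x hx => hf.eq_zero_of_eventuallyEq ?_
  -- Hausdorffness makes `K` closed, so `φ` is the identity on a whole neighbourhood of `x`, as the
  -- derivative argument requires.
  filter_upwards [hK.isClosed.isOpen_compl.mem_nhds hx] with y hy
  exact hΦK 1 (by simp) y hy

end

end ContactGeometry

theorem mainTheorem11 {n : ℕ} {M : Type*} [TopologicalSpace M] [T2Space M] [SigmaCompactSpace M]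
    [Nonempty M] [ChartedSpace (ContactGeometry.Model n) M] [IsManifold (𝓡 (2 * n + 1)) ∞ M]
    (α : ContactGeometry.ContactForm n M) :
    -- `δ_α` is a pseudo-metric on the orbit space of any subset `N`
    (∀ N : Set M,
      (∀ L ∈ ContactGeometry.orbitSpace α N, ContactGeometry.alphaMetric α L L = 0) ∧
      (∀ L₁ ∈ ContactGeometry.orbitSpace α N, ∀ L₂ ∈ ContactGeometry.orbitSpace α N,
        0 ≤ ContactGeometry.alphaMetric α L₁ L₂ ∧
        ContactGeometry.alphaMetric α L₁ L₂ = ContactGeometry.alphaMetric α L₂ L₁) ∧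
      (∀ L₁ ∈ ContactGeometry.orbitSpace α N, ∀ L₂ ∈ ContactGeometry.orbitSpace α N,
        ∀ L₃ ∈ ContactGeometry.orbitSpace α N,
        ContactGeometry.alphaMetric α L₁ L₃ ≤
          ContactGeometry.alphaMetric α L₁ L₂ + ContactGeometry.alphaMetric α L₂ L₃)) ∧
    -- a contactomorphism generated by a contact Hamiltonian distorts `δ_α` by bounded factors
    (∀ (ψ : M ≃ₘ^∞⟮𝓡 (2 * n + 1), 𝓡 (2 * n + 1)⟯ M) (F : ℝ → M → ℝ),
      ContactGeometry.IsGeneratedBy α ψ F →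
      ∃ f : M → ℝ, ContMDiff (𝓡 (2 * n + 1)) 𝓘(ℝ, ℝ) ∞ f ∧
        ContactGeometry.IsConformalFactor α ψ f ∧
        ∃ Cminus Cplus : ℝ, 0 < Cminus ∧ 0 < Cplus ∧
          IsLeast (Set.range fun x => Real.exp (f x)) Cminus ∧
          IsGreatest (Set.range fun x => Real.exp (f x)) Cplus ∧
          ∀ N : Set M, ∀ L₁ ∈ ContactGeometry.orbitSpace α N,
            ∀ L₂ ∈ ContactGeometry.orbitSpace α N,
            ψ '' L₁ ∈ ContactGeometry.orbitSpace α N ∧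
            ψ '' L₂ ∈ ContactGeometry.orbitSpace α N ∧
            Cminus * ContactGeometry.alphaMetric α L₁ L₂ ≤
              ContactGeometry.alphaMetric α (ψ '' L₁) (ψ '' L₂) ∧
            ContactGeometry.alphaMetric α (ψ '' L₁) (ψ '' L₂) ≤
              Cplus * ContactGeometry.alphaMetric α L₁ L₂) := by
  open ContactGeometry in
  refine ⟨fun N => ⟨fun L _ => alphaMetric_self α L, fun L₁ h₁ L₂ h₂ =>
    ⟨alphaMetric_nonneg α L₁ L₂, (alphaMetric_comm_le h₁ h₂).antisymm (alphaMetric_comm_le h₂ h₁)⟩,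
    fun L₁ h₁ L₂ h₂ L₃ h₃ => alphaMetric_triangle h₁ h₂ h₃⟩, fun ψ F hψF => ?_⟩
  obtain ⟨f, hf⟩ := hψF.isContactomorphism
  have hψ : ψ ∈ ContactGeometry.Cont₀ α := ⟨F, hψF⟩
  have hs := hf.hasCompactSupport hψ
  have hc := hf.contMDiff.continuous
  -- The extrema of `f` are attained at `a` and `b`; monotonicity of `exp` carries them to `e^f`.
  obtain ⟨a, ha⟩ := hc.exists_forall_le_of_hasCompactSupport hs
  obtain ⟨b, hb⟩ := hc.exists_forall_ge_of_hasCompactSupport hs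
  have ha' : ∀ x, Real.exp (f a) ≤ Real.exp (f x) := fun x => Real.exp_le_exp.2 (ha x)
  have hb' : ∀ x, Real.exp (f x) ≤ Real.exp (f b) := fun x => Real.exp_le_exp.2 (hb x)
  exact ⟨f, hf.contMDiff, hf, Real.exp (f a), Real.exp (f b), Real.exp_pos _, Real.exp_pos _,
    ⟨mem_range_self a, forall_mem_range.2 ha'⟩, ⟨mem_range_self b, forall_mem_range.2 hb'⟩,
    fun N L₁ h₁ L₂ h₂ => ⟨ContactGeometry.image_mem_orbitSpace hψ h₁,
      ContactGeometry.image_mem_orbitSpace hψ h₂,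
      ContactGeometry.le_alphaMetric_image hψ h₁ h₂ hf (Real.exp_pos _) ha',
      ContactGeometry.alphaMetric_image_le h₁ h₂ hf hb'⟩⟩
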